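/- Let $k$ be a ring (with unit, not necessarily commutative) and let $\mathcal C$ be an essentially small category in which idempotents split and such that the set $\mathcal C(x,x)$ is finite for every object $x$. Let $\mathcal F(\mathcal C;k)$ be the category of all functors from $\mathcal C$ to left $k$-modules. For an abelian category $\mathcal E$ write $\mathrm{Irr}(\mathcal E)$ for the collection of isomorphism classes of simple objects of $\mathcal E$, and write $\mathrm{Iso}(\mathcal C)$ for the collection of isomorphism classes of objects of $\mathcal C$, in each of which a representative $a$ is chosen. Then there is a bijection $$\Phi:\bigsqcup_{[a]\in\mathrm{Iso}(\mathcal C)}\mathrm{Irr}\big(k[\mathrm{Aut}_{\mathcal C}(a)]\text{-}\mathbf{Mod}\big)\xrightarrow{\ \simeq\ }\mathrm{Irr}\big(\mathcal F(\mathcal C;k)\big).$$ Moreover, $\Phi$ preserves the endomorphism division rings of simple objects: if $M$ is a simple left $k[\mathrm{Aut}_{\mathcal C}(a)]$-module and $S$ is a simple functor in the class that $\Phi$ assigns to $M$, then $\mathrm{End}(M)\cong\mathrm{End}(S)$ as rings. The bijection can be chosen so that, for all such $a$, $M$ and $S$, the non-invertible endomorphisms of $a$ act by zero on $S(a)$,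 and $S(a)$ is isomorphic to $M$ as a left $k[\mathrm{Aut}_{\mathcal C}(a)]$-module. -/

import Mathlib

open CategoryTheory

universe w v u

/-- `Irr E` is the collection of isomorphism classes of simple objects of `E`. -/
def Irr (E : Type u) [Category.{v} E] [Limits.HasZeroMorphisms E] : Type u :=
  Quotient ((isIsomorphicSetoid E).comap (Subtype.val : {X : E // Simple X} → E))

/-- The isomorphism class of a simple object. -/
def Irr.mk {E : Type u} [Category.{v} E] [Limits.HasZeroMorphisms E] (X : E) [hX : Simple X] :
    Irr E :=
  Quotient.mk _ ⟨X, hX⟩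

/-- `IsoClass C` is the collection of isomorphism classes of objects of `C`. -/
def IsoClass (C : Type u) [Category.{v} C] : Type u :=
  Quotient (isIsomorphicSetoid C)

/-- The isomorphism class of an object. -/
def IsoClass.mk {C : Type u} [Category.{v} C] (x : C) : IsoClass C :=
  Quotient.mk (isIsomorphicSetoid C) x

/-! A simple functor `S` is generated by any of its nonzero elements, and dually its elements are
separated by the maps into any object `a` with `S(a) ≠ 0`. So morphisms between simple functors
supported at `a` are exactly the `End(a)`-equivariant `k`-linear maps between their values at `a`
(`hom_ext_of_app_eq`, `exists_hom_app_eq`).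

Finiteness and split idempotents yield an apex: an object `a` with `S(a) ≠ 0` whose non-invertible
endomorphisms act by zero (`exists_isApex`). It is unique up to isomorphism (`IsApex.nonempty_iso`),
and `S(a)` is then a simple `k[Aut a]`-module.

Conversely, the non-invertible elements of the finite monoid `End(a)` form a two-sided ideal, so a
simple `k[Aut a]`-module extends by zero to an `End(a)`-module `V`. The image of its left Kan
extension in its right one is simple with value `V` at `a` (`simple_imageFunctor`). It is modelled
by functions on hom-sets, shrunk to the universe of the modules. -/

namespace SimpleFunctor

/-! ### Generation and separation in simple functors. -/

variable {C : Type u} [Category.{v} C] {k : Type w} [Ring k]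

/-- The value at `y` of the subfunctor of `S` generated by `s : S.obj x`. -/
def orbitSpan (S : C ⥤ ModuleCat.{w} k) {x : C} (s : S.obj x) (y : C) : Submodule k (S.obj y) :=
  Submodule.span k (Set.range fun u : x ⟶ y => (S.map u).hom s)

theorem map_mem_orbitSpan (S : C ⥤ ModuleCat.{w} k) {x y z : C} (s : S.obj x) (f : y ⟶ z)
    {t : S.obj y} (ht : t ∈ orbitSpan S s y) : (S.map f).hom t ∈ orbitSpan S s z := by
  refine (Submodule.span_le.mpr ?_ :
    orbitSpan S s y ≤ (orbitSpan S s z).comap (S.map f).hom) ht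
  rintro _ ⟨u, rfl⟩
  exact Submodule.subset_span ⟨u ≫ f, by simp⟩

theorem self_mem_orbitSpan (S : C ⥤ ModuleCat.{w} k) {x : C} (s : S.obj x) :
    s ∈ orbitSpan S s x :=
  Submodule.subset_span ⟨𝟙 x, by simp⟩

/-- The subfunctor of `S` generated by `s : S.obj x`. -/
def orbitFunctor (S : C ⥤ ModuleCat.{w} k) {x : C} (s : S.obj x) : C ⥤ ModuleCat.{w} k where
  obj y := ModuleCat.of k (orbitSpan S s y)
  map f := ModuleCat.ofHom ((S.map f).hom.restrict fun _ ht => map_mem_orbitSpan S s f ht)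
  map_id y := by
    refine ModuleCat.hom_ext (LinearMap.ext fun t => Subtype.ext ?_)
    change (S.map (𝟙 y)).hom t.1 = t.1
    simp
  map_comp f g := by
    refine ModuleCat.hom_ext (LinearMap.ext fun t => Subtype.ext ?_)
    change (S.map (f ≫ g)).hom t.1 = (S.map g).hom ((S.map f).hom t.1)
    simp

/-- The inclusion of the subfunctor generated by an element. -/
def orbitFunctorι (S : C ⥤ ModuleCat.{w} k) {x : C} (s : S.obj x) : orbitFunctor S s ⟶ S where
  app y := ModuleCat.ofHom (orbitSpan S s y).subtype
  naturality _ _ _ := rfl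

theorem orbitSpan_eq_top (S : C ⥤ ModuleCat.{w} k) [Simple S] {x : C} {s : S.obj x} (hs : s ≠ 0)
    (y : C) : orbitSpan S s y = ⊤ := by
  have hmono : Mono (orbitFunctorι S s) := by
    refine (NatTrans.mono_iff_mono_app _).mpr fun z => ?_
    exact (ModuleCat.mono_iff_injective _).mpr Subtype.val_injective
  have hne : orbitFunctorι S s ≠ 0 := fun h => hs <| by
    have := congr_arg (fun η : orbitFunctor S s ⟶ S =>
      (η.app x).hom ⟨s, self_mem_orbitSpan S s⟩) h
    exact this
  have hiso := isIso_of_mono_of_nonzero hne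
  have hepi : Epi ((orbitFunctorι S s).app y) := inferInstance
  rw [ModuleCat.epi_iff_surjective] at hepi
  refine eq_top_iff.mpr fun t _ => ?_
  obtain ⟨t', rfl⟩ := hepi t
  exact t'.2

theorem simple_of_orbitSpan (S : C ⥤ ModuleCat.{w} k) {x₀ : C} {s₀ : S.obj x₀} (hs₀ : s₀ ≠ 0)
    (h : ∀ (x : C) (s : S.obj x), s ≠ 0 → ∀ y, orbitSpan S s y = ⊤) : Simple S where
  mono_isIso_iff_nonzero {T} f _ := by
    have hinj : ∀ y, Function.Injective (f.app y).hom := fun y =>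
      (ModuleCat.mono_iff_injective _).mp ((NatTrans.mono_iff_mono_app f).mp inferInstance y)
    constructor
    · rintro _ rfl
      have hepi : Epi ((0 : T ⟶ S).app x₀) := inferInstance
      rw [ModuleCat.epi_iff_surjective] at hepi
      obtain ⟨t, rfl⟩ := hepi s₀
      exact hs₀ rfl
    · intro hf
      obtain ⟨x, t, ht⟩ : ∃ (x : C) (t : T.obj x), (f.app x).hom t ≠ 0 := by
        by_contra! hcon
        exact hf (by ext x t; exact hcon x t)
      rw [NatTrans.isIso_iff_isIso_app]
      intro y
      have hsurj : LinearMap.range (f.app y).hom = ⊤ := by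
        rw [eq_top_iff, ← h x _ ht y, orbitSpan, Submodule.span_le]
        rintro _ ⟨u, rfl⟩
        exact ⟨(T.map u).hom t, NatTrans.naturality_apply f u t⟩
      rw [ConcreteCategory.isIso_iff_bijective]
      exact ⟨hinj y, LinearMap.range_eq_top.mp hsurj⟩

theorem exists_map_ne_zero (S : C ⥤ ModuleCat.{w} k) [Simple S] {x y : C} {s : S.obj x}
    (hs : s ≠ 0) [Nontrivial (S.obj y)] : ∃ u : x ⟶ y, (S.map u).hom s ≠ 0 := by
  by_contra! hcon
  obtain ⟨t, ht⟩ := exists_ne (0 : S.obj y)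
  have hmem : t ∈ orbitSpan S s y := by simp [orbitSpan_eq_top S hs y]
  refine ht ((Submodule.mem_bot k).mp ((Submodule.span_le.mpr ?_ : orbitSpan S s y ≤ ⊥) hmem))
  rintro _ ⟨u, rfl⟩
  exact hcon u

theorem eq_of_map_eq (S : C ⥤ ModuleCat.{w} k) [Simple S] {x : C} (a : C) [Nontrivial (S.obj a)]
    {s t : S.obj x} (h : ∀ f : x ⟶ a, (S.map f).hom s = (S.map f).hom t) : s = t := by
  by_contra hst
  obtain ⟨u, hu⟩ := exists_map_ne_zero S (y := a) (sub_ne_zero.mpr hst)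
  exact hu (by rw [map_sub, h u, sub_self])

theorem exists_nontrivial_obj (S : C ⥤ ModuleCat.{w} k) [Simple S] :
    ∃ x, Nontrivial (S.obj x) := by
  by_contra! hcon
  refine id_nonzero S ?_
  ext x t
  exact Subsingleton.elim _ _

theorem hom_ext_of_app_eq {S T : C ⥤ ModuleCat.{w} k} [Simple S] (a : C) [Nontrivial (S.obj a)]
    {η ξ : S ⟶ T} (h : η.app a = ξ.app a) : η = ξ := by
  obtain ⟨s, hs⟩ := exists_ne (0 : S.obj a)
  ext x t
  have hmem : t ∈ orbitSpan S s x := by simp [orbitSpan_eq_top S hs x]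
  refine (Submodule.span_le.mpr ?_ :
    orbitSpan S s x ≤ LinearMap.eqLocus (η.app x).hom (ξ.app x).hom) hmem
  rintro _ ⟨u, rfl⟩
  have h₁ := NatTrans.naturality_apply η u s
  have h₂ := NatTrans.naturality_apply ξ u s
  rw [h] at h₁
  exact h₁.trans h₂.symm

/-- The image `t` of `s` is forced by its images under all maps into `a`. It exists because `S` is
generated by `s₀`; its uniqueness, from `eq_of_map_eq` for `T`, gives linearity and naturality. -/
theorem exists_hom_app_eq {S T : C ⥤ ModuleCat.{w} k} [Simple S] [Simple T] (a : C)
    [Nontrivial (S.obj a)] [Nontrivial (T.obj a)] (θ : S.obj a →ₗ[k] T.obj a)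
    (hθ : ∀ (f : a ⟶ a) (m : S.obj a), θ ((S.map f).hom m) = (T.map f).hom (θ m)) :
    ∃ η : S ⟶ T, (η.app a).hom = θ := by
  obtain ⟨s₀, hs₀⟩ := exists_ne (0 : S.obj a)
  have key : ∀ (x : C) (s : S.obj x), ∃ t : T.obj x,
      ∀ f : x ⟶ a, (T.map f).hom t = θ ((S.map f).hom s) := by
    intro x s
    have hmem : s ∈ orbitSpan S s₀ x := by simp [orbitSpan_eq_top S hs₀ x]
    induction hmem using Submodule.span_induction with
    | mem _ hs =>
      obtain ⟨u, rfl⟩ := hs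
      refine ⟨(T.map u).hom (θ s₀), fun f => ?_⟩
      simpa using (hθ (u ≫ f) s₀).symm
    | zero => exact ⟨0, by simp⟩
    | add s s' _ _ h h' =>
      obtain ⟨t, ht⟩ := h
      obtain ⟨t', ht'⟩ := h'
      exact ⟨t + t', fun f => by simp only [map_add, ht, ht']⟩
    | smul r s _ h =>
      obtain ⟨t, ht⟩ := h
      exact ⟨r • t, fun f => by simp only [map_smul, ht]⟩
  choose φ hφ using key
  refine ⟨{ app := fun x => ModuleCat.ofHom
              { toFun := φ x
                map_add' := fun s t => eq_of_map_eq T a fun f => by simp only [map_add, hφ]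
                map_smul' := fun r s => eq_of_map_eq T a fun f => by
                  simp only [map_smul, hφ, RingHom.id_apply] }
            naturality := fun x y u => ?_ }, ?_⟩
  · ext s
    refine eq_of_map_eq T a fun f => ?_
    have h := hφ x s (u ≫ f)
    simp only [Functor.map_comp, ModuleCat.hom_comp, LinearMap.comp_apply] at h
    exact (hφ y _ f).trans h.symm
  · ext m
    refine eq_of_map_eq T a fun f => ?_
    exact (hφ a m f).trans (hθ f m)

/-! ### Finite endomorphism monoids. -/

theorem isIso_of_isIso_comp_left {a : C} [Finite (a ⟶ a)] {f g : a ⟶ a} (h : IsIso (f ≫ g)) :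
    IsIso f := by
  have : Finite (End a) := ‹Finite (a ⟶ a)›
  have h₁ : f ≫ g ≫ inv (f ≫ g) = 𝟙 a := by rw [← Category.assoc]; exact IsIso.hom_inv_id _
  have h₂ : (g ≫ inv (f ≫ g)) ≫ f = 𝟙 a := by
    have := mul_eq_one_symm (M := End a) (a := (g ≫ inv (f ≫ g) : a ⟶ a)) (b := f) h₁
    exact this
  exact ⟨_, h₁, h₂⟩

theorem isIso_of_isIso_comp_right {a : C} [Finite (a ⟶ a)] {f g : a ⟶ a} (h : IsIso (f ≫ g)) :
    IsIso g := by
  have := isIso_of_isIso_comp_left h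
  exact IsIso.of_isIso_comp_left f g

theorem exists_pow_isIdempotentElem {N : Type*} [Monoid N] [Finite N] (x : N) :
    ∃ n : ℕ, IsIdempotentElem (x ^ (n + 1)) := by
  obtain ⟨i, j, hij, h⟩ := Finite.exists_ne_map_eq_of_infinite fun n : ℕ => x ^ n
  wlog hlt : i < j generalizing i j
  · exact this j i hij.symm h.symm (by omega)
  obtain ⟨d, rfl⟩ : ∃ d, j = i + (d + 1) := ⟨j - i - 1, by omega⟩
  have hp : ∀ c n, i ≤ n → x ^ (n + c * (d + 1)) = x ^ n := by
    intro c n hn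
    induction c with
    | zero => simp
    | succ c ih =>
      obtain ⟨e, rfl⟩ := Nat.exists_eq_add_of_le hn
      rw [show i + e + (c + 1) * (d + 1) = (i + (d + 1)) + (e + c * (d + 1)) by ring, pow_add]
      change x ^ i = x ^ (i + (d + 1)) at h
      rw [← h, ← pow_add, ← ih]
      congr 1
      ring
  -- The exponent `(i + 1) * (d + 1)` is a multiple of the period `d + 1` and at least `i`, where
  -- periodicity begins.
  refine ⟨(i + 1) * (d + 1) - 1, ?_⟩
  rw [Nat.sub_add_cancel (Nat.mul_pos i.succ_pos d.succ_pos), IsIdempotentElem, ← pow_add]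
  exact hp (i + 1) _ (by nlinarith)

/-! ### Existence and uniqueness of apexes. -/

/-- The object `a` supports `S`, and the non-invertible endomorphisms of `a` act by zero. -/
structure IsApex (S : C ⥤ ModuleCat.{w} k) (a : C) : Prop where
  nontrivial : Nontrivial (S.obj a)
  map_eq_zero : ∀ f : a ⟶ a, ¬ IsIso f → S.map f = 0

/-- Follow a nonzero element along `a ⟶ b ⟶ a ⟶ b` without killing it. Both two-step composites act
nontrivially, hence are invertible, so the middle map is split on both sides. -/
theorem IsApex.nonempty_iso {S : C ⥤ ModuleCat.{w} k} [Simple S] {a b : C} (ha : IsApex S a)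
    (hb : IsApex S b) : Nonempty (a ≅ b) := by
  have := ha.nontrivial
  have := hb.nontrivial
  obtain ⟨m, hm⟩ := exists_ne (0 : S.obj a)
  obtain ⟨f, hf⟩ := exists_map_ne_zero S (y := b) hm
  obtain ⟨g, hg⟩ := exists_map_ne_zero S (y := a) hf
  obtain ⟨h, hh⟩ := exists_map_ne_zero S (y := b) hg
  have h₁ : IsIso (f ≫ g) := by
    by_contra hcon
    refine hg ?_
    have := ha.map_eq_zero _ hcon
    rw [Functor.map_comp] at this
    exact congr_arg (fun φ : S.obj a ⟶ S.obj a => φ.hom m) this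
  have h₂ : IsIso (g ≫ h) := by
    by_contra hcon
    refine hh ?_
    have := hb.map_eq_zero _ hcon
    rw [Functor.map_comp] at this
    exact congr_arg (fun φ : S.obj b ⟶ S.obj b => φ.hom ((S.map f).hom m)) this
  have : IsSplitMono g := ⟨⟨h ≫ inv (g ≫ h), by rw [← Category.assoc, IsIso.hom_inv_id]⟩⟩
  have : IsSplitEpi g := ⟨⟨inv (f ≫ g) ≫ f, by rw [Category.assoc, IsIso.inv_hom_id]⟩⟩
  have : IsIso g := isIso_of_epi_of_isSplitMono g
  exact ⟨(asIso g).symm⟩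

theorem IsApex.of_iso {S : C ⥤ ModuleCat.{w} k} {a b : C} (ha : IsApex S a) (i : a ≅ b) :
    IsApex S b where
  nontrivial := by
    have := ha.nontrivial
    exact (S.mapIso i).toLinearEquiv.symm.toEquiv.nontrivial
  map_eq_zero f hf := by
    have h₀ : S.map (i.hom ≫ f ≫ i.inv) = 0 := ha.map_eq_zero _ fun h => hf <| by
      have : f = i.inv ≫ (i.hom ≫ f ≫ i.inv) ≫ i.hom := by simp
      rw [this]
      infer_instance
    have : f = i.inv ≫ (i.hom ≫ f ≫ i.inv) ≫ i.hom := by simp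
    rw [this, S.map_comp, S.map_comp, h₀]
    simp

theorem exists_isApex [IsIdempotentComplete C] (hfin : ∀ x : C, Finite (x ⟶ x))
    (S : C ⥤ ModuleCat.{w} k) [Simple S] : ∃ a, IsApex S a := by
  obtain ⟨a, ha, hmin⟩ : ∃ a : C, Nontrivial (S.obj a) ∧
      ∀ b : C, Nontrivial (S.obj b) → Nat.card (a ⟶ a) ≤ Nat.card (b ⟶ b) := by
    let P : Set C := {x | Nontrivial (S.obj x)}
    have hP : P.Nonempty := exists_nontrivial_obj S
    refine ⟨Function.argminOn (fun x : C => Nat.card (x ⟶ x)) P hP,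
      Function.argminOn_mem (fun x : C => Nat.card (x ⟶ x)) P hP,
      fun b hb => Function.argminOn_le (fun x : C => Nat.card (x ⟶ x)) P hb⟩
  have := hfin a
  -- If `p` splits through `b` with `S(b) ≠ 0`, then `End(b)` embeds in `End(a)`; minimality of `a`
  -- makes this bijective, so the identity factors through `b` and `p = 𝟙 a`.
  have hidem : ∀ p : a ⟶ a, p ≫ p = p → p ≠ 𝟙 a → S.map p = 0 := by
    intro p hp hne
    obtain ⟨b, i, q, hiq, hqi⟩ := IsIdempotentComplete.idempotents_split a p hp
    by_cases hb : Nontrivial (S.obj b)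
    · have hinj : Function.Injective fun h : b ⟶ b => q ≫ h ≫ i := by
        intro h h' hh
        have := congr_arg (fun t => i ≫ t ≫ q) hh
        simpa [hiq, reassoc_of% hiq] using this
      have := hfin b
      obtain ⟨h, hh⟩ := (hinj.bijective_of_nat_card_le (hmin b hb)).surjective (𝟙 a)
      change q ≫ h ≫ i = 𝟙 a at hh
      refine absurd ?_ hne
      calc p = p ≫ q ≫ h ≫ i := by rw [hh, Category.comp_id]
        _ = q ≫ h ≫ i := by rw [← hqi]; simp [reassoc_of% hiq]
        _ = 𝟙 a := hh
    · rw [not_nontrivial_iff_subsingleton] at hb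
      rw [← hqi, S.map_comp]
      ext m
      have : (S.map q).hom m = 0 := Subsingleton.elim _ _
      simp [this]
  obtain ⟨m, hm⟩ := exists_ne (0 : S.obj a)
  -- Minimizing this ideal among the `p` not killing `m` makes `S(p) m` an element killed by every
  -- non-invertible endomorphism.
  let ideal : (a ⟶ a) → Set (a ⟶ a) := fun p => Set.range fun q : a ⟶ a => p ≫ q
  obtain ⟨p, hpm, hpmin⟩ : ∃ p : a ⟶ a, (S.map p).hom m ≠ 0 ∧
      ∀ q : a ⟶ a, (S.map q).hom m ≠ 0 → (ideal p).ncard ≤ (ideal q).ncard := by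
    let P : Set (a ⟶ a) := {p | (S.map p).hom m ≠ 0}
    have hP : P.Nonempty := ⟨𝟙 a, by simpa [P] using hm⟩
    exact ⟨Function.argminOn (fun p => (ideal p).ncard) P hP,
      Function.argminOn_mem (fun p => (ideal p).ncard) P hP,
      fun q hq => Function.argminOn_le (fun p => (ideal p).ncard) P hq⟩
  have hkill : ∀ q : a ⟶ a, ¬ IsIso q → (S.map q).hom ((S.map p).hom m) = 0 := by
    intro q hq
    by_contra hcon
    have hcon' : (S.map (p ≫ q)).hom m ≠ 0 := by simpa using hcon
    have hsub : ideal (p ≫ q) ⊆ ideal p := by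
      rintro _ ⟨r, rfl⟩
      exact ⟨q ≫ r, by simp⟩
    have heq := Set.eq_of_subset_of_ncard_le hsub (hpmin _ hcon') (Set.toFinite _)
    obtain ⟨r, hr⟩ : p ∈ ideal (p ≫ q) := heq ▸ ⟨𝟙 a, by simp⟩
    change (p ≫ q) ≫ r = p at hr
    rw [Category.assoc] at hr
    -- Since `p` absorbs `z`, it absorbs an idempotent power of `z`. That power is not the identity,
    -- as `q` is not invertible, so `S` kills it and hence `p`.
    let z : End a := q ≫ r
    have hpow : ∀ n : ℕ, p ≫ (z ^ n : End a) = p := by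
      intro n
      induction n with
      | zero => exact Category.comp_id p
      | succ n ih => rw [pow_succ', End.mul_def, ← Category.assoc, ih, hr]
    have : Finite (End a) := hfin a
    obtain ⟨n, hn⟩ := exists_pow_isIdempotentElem z
    have hzero : S.map (z ^ (n + 1) : End a) = 0 := by
      refine hidem _ hn fun h1 => hq ?_
      have h2 : z ≫ (z ^ n : End a) = 𝟙 a := by rw [← h1, pow_succ, End.mul_def]
      have h3 : IsIso (z ≫ (z ^ n : End a)) := by rw [h2]; infer_instance
      exact isIso_of_isIso_comp_left (isIso_of_isIso_comp_left h3)
    refine hpm ?_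
    rw [← hpow (n + 1), S.map_comp, hzero]
    simp
  -- `S(p) m` generates `S(a)`, and `u ≫ f` is non-invertible whenever `f` is.
  refine ⟨a, ha, fun f hf => ?_⟩
  ext t
  have hmem : t ∈ orbitSpan S ((S.map p).hom m) a := by simp [orbitSpan_eq_top S hpm a]
  refine (Submodule.span_le.mpr ?_ : orbitSpan S _ a ≤ LinearMap.ker (S.map f).hom) hmem
  rintro _ ⟨u, rfl⟩
  have := hkill (u ≫ f) fun h => hf (isIso_of_isIso_comp_right h)
  simpa using this

/-! ### The simple functor attached to an irreducible `End(a)`-module. -/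

section ImageFunctor

variable {C : Type u} [Category.{v} C] [LocallySmall.{w} C] {k : Type w} [Ring k]
  {a : C} {V : Type w} [AddCommGroup V] [Module k V] (act : (a ⟶ a) → V →ₗ[k] V)

/-- The function `f ↦ (u ≫ f) • m` on `x ⟶ a`. -/
noncomputable def genFun {x : C} (u : a ⟶ x) : V →ₗ[k] (Shrink.{w} (x ⟶ a) → V) :=
  LinearMap.pi fun f => act (u ≫ (equivShrink _).symm f)

/-- The span of all functions `f ↦ (u ≫ f) • m` on `x ⟶ a`. -/
noncomputable def imageSpan (x : C) : Submodule k (Shrink.{w} (x ⟶ a) → V) :=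
  ⨆ u : a ⟶ x, LinearMap.range (genFun act u)

/-- Precomposition with a morphism. -/
noncomputable def precomp {x y : C} (g : x ⟶ y) :
    (Shrink.{w} (x ⟶ a) → V) →ₗ[k] (Shrink.{w} (y ⟶ a) → V) :=
  LinearMap.funLeft k V fun f => equivShrink _ (g ≫ (equivShrink _).symm f)

theorem precomp_genFun {x y : C} (g : x ⟶ y) (u : a ⟶ x) (m : V) :
    precomp (k := k) g (genFun act u m) = genFun act (u ≫ g) m := by
  ext f
  simp [precomp, genFun, LinearMap.funLeft]

theorem precomp_mem {x y : C} (g : x ⟶ y) {φ : Shrink.{w} (x ⟶ a) → V}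
    (hφ : φ ∈ imageSpan act x) : precomp (k := k) g φ ∈ imageSpan act y := by
  refine (iSup_le ?_ : imageSpan act x ≤ (imageSpan act y).comap (precomp g)) hφ
  rintro u _ ⟨m, rfl⟩
  refine Submodule.mem_iSup_of_mem (u ≫ g) ⟨m, ?_⟩
  exact (precomp_genFun act g u m).symm

/-- The image of the map from the left to the right Kan extension of `V` from `a` to `C`. -/
noncomputable def imageFunctor : C ⥤ ModuleCat.{w} k where
  obj x := ModuleCat.of k (imageSpan act x)
  map g := ModuleCat.ofHom ((precomp g).restrict fun _ h => precomp_mem act g h)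
  map_id x := by
    refine ModuleCat.hom_ext (LinearMap.ext fun φ => Subtype.ext (funext fun f => ?_))
    change φ.1 _ = φ.1 _
    simp
  map_comp g h := by
    refine ModuleCat.hom_ext (LinearMap.ext fun φ => Subtype.ext (funext fun f => ?_))
    change φ.1 _ = φ.1 _
    simp

theorem imageFunctor_map_apply {x y : C} (g : x ⟶ y) (φ : (imageFunctor act).obj x) (f : y ⟶ a) :
    (((imageFunctor act).map g).hom φ).1 (equivShrink _ f) = φ.1 (equivShrink _ (g ≫ f)) := by
  change φ.1 _ = φ.1 _
  simp

variable {act}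

/-- Holds on generators by associativity. At `x = a` it makes a function determined by its value at
`𝟙 a`. -/
theorem equivariant_of_mem (act_comp : ∀ f g, act (f ≫ g) = act g ∘ₗ act f) {x : C}
    {φ : Shrink.{w} (x ⟶ a) → V} (hφ : φ ∈ imageSpan act x) (f : x ⟶ a) (g : a ⟶ a) :
    φ (equivShrink _ (f ≫ g)) = act g (φ (equivShrink _ f)) := by
  refine (iSup_le ?_ : imageSpan act x ≤
    LinearMap.eqLocus (LinearMap.proj (equivShrink _ (f ≫ g)))
      (act g ∘ₗ LinearMap.proj (equivShrink _ f))) hφ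
  rintro u _ ⟨m, rfl⟩
  have := LinearMap.congr_fun (act_comp (u ≫ f) g) m
  simpa [genFun] using this

/-- The image functor takes the value `V` at `a`, by evaluation at the identity. -/
noncomputable def imageFunctorEval (act_id : act (𝟙 a) = LinearMap.id)
    (act_comp : ∀ f g, act (f ≫ g) = act g ∘ₗ act f) : (imageFunctor act).obj a ≃ₗ[k] V where
  toFun φ := φ.1 (equivShrink _ (𝟙 a))
  map_add' _ _ := rfl
  map_smul' _ _ := rfl
  invFun m := ⟨genFun act (𝟙 a) m, Submodule.mem_iSup_of_mem (𝟙 a) ⟨m, rfl⟩⟩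
  left_inv φ := by
    refine Subtype.ext (funext fun f => ?_)
    obtain ⟨f, rfl⟩ := (equivShrink _).surjective f
    have := equivariant_of_mem act_comp φ.2 (𝟙 a) f
    rw [Category.id_comp] at this
    simpa [genFun] using this.symm
  right_inv m := by simp [genFun, act_id]

theorem imageFunctorEval_map (act_id : act (𝟙 a) = LinearMap.id)
    (act_comp : ∀ f g, act (f ≫ g) = act g ∘ₗ act f) (g : a ⟶ a)
    (φ : (imageFunctor act).obj a) :
    imageFunctorEval act_id act_comp (((imageFunctor act).map g).hom φ) =
      act g (imageFunctorEval act_id act_comp φ) := by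
  have h := equivariant_of_mem act_comp φ.2 (𝟙 a) g
  rw [Category.id_comp] at h
  refine (imageFunctor_map_apply act g φ (𝟙 a)).trans ?_
  rw [Category.comp_id]
  exact h

/-- A nonzero function is nonzero at some `f : x ⟶ a`. Pushed along `f` it becomes a nonzero element
of `V`, which generates `V` by irreducibility, and `V` generates the functor by construction. -/
theorem simple_imageFunctor [Nontrivial V] (act_id : act (𝟙 a) = LinearMap.id)
    (act_comp : ∀ f g, act (f ≫ g) = act g ∘ₗ act f)
    (irred : ∀ m : V, m ≠ 0 → Submodule.span k (Set.range fun f => act f m) = ⊤) :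
    Simple (imageFunctor act) := by
  set ev := imageFunctorEval act_id act_comp with hev
  obtain ⟨m₀, hm₀⟩ := exists_ne (0 : V)
  refine simple_of_orbitSpan _ (x₀ := a) (s₀ := ev.symm m₀) (by simpa using hm₀) ?_
  intro x s hs y
  obtain ⟨f, hf⟩ : ∃ f : x ⟶ a, s.1 (equivShrink _ f) ≠ 0 := by
    by_contra! hcon
    refine hs (Subtype.ext (funext fun f => ?_))
    obtain ⟨f, rfl⟩ := (equivShrink _).surjective f
    exact hcon f
  have hmem : ∀ m : V, ev.symm m ∈ orbitSpan (imageFunctor act) s a := by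
    intro m
    refine (?_ : ⊤ ≤ (orbitSpan (imageFunctor act) s a).comap ev.symm.toLinearMap)
      (Submodule.mem_top (x := m))
    rw [← irred _ hf, Submodule.span_le]
    rintro _ ⟨h, rfl⟩
    refine Submodule.subset_span ⟨f ≫ h, ?_⟩
    refine ev.injective ?_
    refine (imageFunctor_map_apply act (f ≫ h) s (𝟙 a)).trans ?_
    rw [Category.comp_id, equivariant_of_mem act_comp s.2]
    exact (ev.apply_symm_apply _).symm
  refine eq_top_iff.mpr fun t _ => ?_
  have hle : imageSpan act y ≤
      (orbitSpan (imageFunctor act) s y).map (imageSpan act y).subtype := by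
    refine iSup_le ?_
    rintro u _ ⟨m, rfl⟩
    refine ⟨((imageFunctor act).map u).hom (ev.symm m), map_mem_orbitSpan _ _ u (hmem m), ?_⟩
    refine (precomp_genFun act u (𝟙 a) m).trans ?_
    rw [Category.id_comp]
  obtain ⟨t', ht', h⟩ := hle t.2
  rwa [← Subtype.ext h]

end ImageFunctor

/-! ### Comparing modules and functors at the apex. -/

section Realization

variable {C : Type u} [Category.{v} C] {k : Type w} [Ring k] {a : C}

/-- The functor `S` has apex `a` with value the `k[Aut a]`-module `M` there. -/
structure Realization (M : ModuleCat.{w} (MonoidAlgebra k (Aut a))) (S : C ⥤ ModuleCat.{w} k) where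
  map_eq_zero : ∀ f : a ⟶ a, ¬ IsIso f → S.map f = 0
  equiv : S.obj a ≃+ M
  equiv_smul : ∀ (r : k) (g : Aut a) (m : S.obj a),
    equiv (r • (S.map g.hom).hom m) = MonoidAlgebra.single g r • equiv m

namespace Realization

variable {M M' : ModuleCat.{w} (MonoidAlgebra k (Aut a))} {S S' : C ⥤ ModuleCat.{w} k}

theorem nontrivial_obj (R : Realization M S) [Simple M] : Nontrivial (S.obj a) := by
  have : Nontrivial M := IsSimpleModule.nontrivial (MonoidAlgebra k (Aut a)) M
  exact R.equiv.toEquiv.nontrivial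

/-- The map of modules that a map of functors induces on values at the apex. -/
noncomputable def mapHom (R : Realization M S) (R' : Realization M' S') (η : S ⟶ S') : M ⟶ M' :=
  ModuleCat.ofHom
    { toFun := fun m => R'.equiv ((η.app a).hom (R.equiv.symm m))
      map_add' := fun m n => by simp only [map_add]
      map_smul' := fun z m => by
        obtain ⟨m, rfl⟩ := R.equiv.surjective m
        simp only [RingHom.id_apply, AddEquiv.symm_apply_apply]
        induction z using MonoidAlgebra.induction_linear with
        | zero => simp
        | add z z' h h' => simp only [add_smul, map_add, h, h']
        | single g r =>
          rw [← R.equiv_smul, ← R'.equiv_smul, AddEquiv.symm_apply_apply, map_smul]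
          congr 2
          exact NatTrans.naturality_apply η g.hom m }

theorem mapHom_apply (R : Realization M S) (R' : Realization M' S') (η : S ⟶ S') (m : S.obj a) :
    (R.mapHom R' η).hom (R.equiv m) = R'.equiv ((η.app a).hom m) := by
  change R'.equiv ((η.app a).hom (R.equiv.symm (R.equiv m))) = _
  rw [AddEquiv.symm_apply_apply]

theorem mapHom_injective (R : Realization M S) (R' : Realization M' S') [Simple M] [Simple S] :
    Function.Injective (R.mapHom R') := by
  intro η ξ h
  have := R.nontrivial_obj
  refine hom_ext_of_app_eq a ?_
  ext m
  refine R'.equiv.injective ?_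
  rw [← R.mapHom_apply, ← R.mapHom_apply, h]

theorem equiv_symm_smul (R : Realization M S) (r : k) (g : Aut a) (m : M) :
    R.equiv.symm (MonoidAlgebra.single g r • m) = r • (S.map g.hom).hom (R.equiv.symm m) := by
  rw [AddEquiv.symm_apply_eq, R.equiv_smul, AddEquiv.apply_symm_apply]

/-- Non-invertible endomorphisms of `a` act by zero on both sides, so `k[Aut a]`-linearity already
gives `End(a)`-equivariance and `exists_hom_app_eq` applies. -/
theorem mapHom_surjective (R : Realization M S) (R' : Realization M' S') [Simple M] [Simple M']
    [Simple S] [Simple S'] : Function.Surjective (R.mapHom R') := by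
  intro φ
  have := R.nontrivial_obj
  have := R'.nontrivial_obj
  have hφ : ∀ (r : k) (g : Aut a) (m : S.obj a),
      R'.equiv.symm (φ.hom (R.equiv (r • (S.map g.hom).hom m))) =
        r • (S'.map g.hom).hom (R'.equiv.symm (φ.hom (R.equiv m))) := fun r g m => by
    rw [R.equiv_smul, map_smul, R'.equiv_symm_smul]
  let θ : S.obj a →ₗ[k] S'.obj a :=
    { toFun := fun m => R'.equiv.symm (φ.hom (R.equiv m))
      map_add' := fun m n => by simp only [map_add]
      map_smul' := fun r m => by simpa using hφ r (Iso.refl a) m }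
  obtain ⟨η, hη⟩ := exists_hom_app_eq a θ fun f m => by
    by_cases hf : IsIso f
    · have h := hφ 1 (asIso f) m
      rw [one_smul, one_smul] at h
      exact h
    · rw [R.map_eq_zero f hf, R'.map_eq_zero f hf]
      exact map_zero θ
  refine ⟨η, ?_⟩
  ext m
  obtain ⟨m, rfl⟩ := R.equiv.surjective m
  rw [mapHom_apply, hη]
  exact R'.equiv.apply_symm_apply _

/-- Taking values at the apex identifies the endomorphism rings. -/
noncomputable def endEquiv (R : Realization M S) [Simple M] [Simple S] : End S ≃+* End M :=
  RingEquiv.ofBijective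
    ({
      toFun := fun η : End S => (R.mapHom R η : End M)
      map_one' := by
        refine ModuleCat.hom_ext (LinearMap.ext fun m => ?_)
        exact R.equiv.apply_symm_apply m
      map_mul' := fun η ξ => by
        refine ModuleCat.hom_ext (LinearMap.ext fun m => ?_)
        obtain ⟨m, rfl⟩ := R.equiv.surjective m
        refine (R.mapHom_apply R _ m).trans ?_
        change _ = (R.mapHom R η).hom ((R.mapHom R ξ).hom (R.equiv m))
        rw [mapHom_apply, mapHom_apply]
        rfl
      map_zero' := by
        refine ModuleCat.hom_ext (LinearMap.ext fun m => ?_)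
        exact map_zero R.equiv
      map_add' := fun η ξ => by
        refine ModuleCat.hom_ext (LinearMap.ext fun m => ?_)
        exact map_add R.equiv _ _ } : End S →+* End M)
    ⟨R.mapHom_injective R, R.mapHom_surjective R⟩

theorem nonempty_iso_module (R : Realization M S) (R' : Realization M' S') [Simple M] [Simple M']
    [Simple S] (i : S ≅ S') : Nonempty (M ≅ M') := by
  have hne : R.mapHom R' i.hom ≠ 0 := by
    have := R.nontrivial_obj
    obtain ⟨m, hm⟩ := exists_ne (0 : S.obj a)
    intro h
    have h₁ := R.mapHom_apply R' i.hom m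
    rw [h] at h₁
    have h₂ : (i.hom.app a).hom m = 0 := R'.equiv.injective (h₁.symm.trans (map_zero _).symm)
    have h₃ : (i.inv.app a).hom ((i.hom.app a).hom m) = m := by simp
    exact hm (by rw [← h₃, h₂, map_zero])
  have := isIso_of_hom_simple hne
  exact ⟨asIso (R.mapHom R' i.hom)⟩

theorem nonempty_iso_functor (R : Realization M S) (R' : Realization M' S') [Simple M]
    [Simple M'] [Simple S] [Simple S'] (i : M ≅ M') : Nonempty (S ≅ S') := by
  obtain ⟨η, hη⟩ := R.mapHom_surjective R' i.hom
  have hne : η ≠ 0 := by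
    rintro rfl
    refine id_nonzero M ?_
    rw [← i.hom_inv_id, ← hη]
    ext m
    change i.inv.hom (R'.equiv 0) = 0
    rw [map_zero, map_zero]
  have := isIso_of_hom_simple hne
  exact ⟨asIso η⟩

theorem isApex (R : Realization M S) [Simple M] : IsApex S a := ⟨R.nontrivial_obj, R.map_eq_zero⟩

/-- Transport of a realization along an isomorphism of functors. -/
def ofIso (R : Realization M S) (i : S ≅ S') : Realization M S' where
  map_eq_zero f hf := by
    rw [← cancel_epi (i.hom.app a), ← i.hom.naturality, R.map_eq_zero f hf]
    simp
  equiv := (i.app a).toLinearEquiv.symm.toAddEquiv.trans R.equiv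
  equiv_smul r g m := by
    change R.equiv ((i.inv.app a).hom (r • (S'.map g.hom).hom m)) =
      _ • R.equiv ((i.inv.app a).hom m)
    rw [← R.equiv_smul, map_smul]
    congr 2
    exact NatTrans.naturality_apply i.inv g.hom m

/-- Transport of a realization along an isomorphism of modules. -/
noncomputable def ofModuleIso (R : Realization M S) (i : M ≅ M') : Realization M' S where
  map_eq_zero := R.map_eq_zero
  equiv := R.equiv.trans i.toLinearEquiv.toAddEquiv
  equiv_smul r g m := by
    change i.hom.hom (R.equiv _) = _ • i.hom.hom (R.equiv m)
    rw [R.equiv_smul, map_smul]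

end Realization

end Realization

/-! ### From a simple functor to a simple module. -/

section Value

variable {C : Type u} [Category.{v} C] {k : Type w} [Ring k]

/-- An invertible endomorphism as an automorphism. -/
noncomputable def autOfIsIso {a : C} (f : a ⟶ a) (hf : IsIso f) : Aut a := asIso f

/-- The action of automorphisms of `a` on the value of a functor at `a`. -/
def autHom (S : C ⥤ ModuleCat.{w} k) (a : C) : Aut a →* AddMonoid.End (S.obj a) where
  toFun g := (S.map g.hom).hom.toAddMonoidHom
  map_one' := by
    ext m
    change (S.map (𝟙 a)).hom m = m
    simp
  map_mul' g h := by
    ext m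
    change (S.map (h.hom ≫ g.hom)).hom m = (S.map g.hom).hom ((S.map h.hom).hom m)
    simp

/-- The action of `k[Aut a]` on the value of a functor at `a`. -/
noncomputable def valueHom (S : C ⥤ ModuleCat.{w} k) (a : C) :
    MonoidAlgebra k (Aut a) →+* AddMonoid.End (S.obj a) :=
  MonoidAlgebra.liftNCRingHom (Module.toAddMonoidEnd k (S.obj a)) (autHom S a) fun r g => by
    ext m
    exact (map_smul (S.map g.hom).hom r m).symm

/-- The value of a functor at `a` as a `k[Aut a]`-module. -/
noncomputable def valueModule (S : C ⥤ ModuleCat.{w} k) (a : C) :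
    ModuleCat.{w} (MonoidAlgebra k (Aut a)) :=
  letI := Module.compHom (S.obj a) (valueHom S a)
  ModuleCat.of _ (S.obj a)

/-- The identity of the value of a functor at `a`. -/
noncomputable def valueEquiv (S : C ⥤ ModuleCat.{w} k) (a : C) : S.obj a ≃+ valueModule S a :=
  AddEquiv.refl _

theorem valueEquiv_smul (S : C ⥤ ModuleCat.{w} k) (a : C) (r : k) (g : Aut a) (m : S.obj a) :
    valueEquiv S a (r • (S.map g.hom).hom m) =
      MonoidAlgebra.single g r • valueEquiv S a m := by
  have h : valueHom S a (MonoidAlgebra.single g r) =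
      Module.toAddMonoidEnd k (S.obj a) r * autHom S a g :=
    MonoidAlgebra.liftNCRingHom_single ..
  exact (DFunLike.congr_fun h m).symm

/-- A functor with apex `a` is realized by its value at `a`. -/
noncomputable def IsApex.realization {S : C ⥤ ModuleCat.{w} k} {a : C} (ha : IsApex S a) :
    Realization (valueModule S a) S where
  map_eq_zero := ha.map_eq_zero
  equiv := valueEquiv S a
  equiv_smul := valueEquiv_smul S a

/-- A nonzero `m` generates `S(a)` under all endomorphisms of `a`; the non-invertible ones
contribute zero, so `k[Aut a]` alone suffices. -/
theorem IsApex.simple_valueModule {S : C ⥤ ModuleCat.{w} k} [Simple S] {a : C}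
    (ha : IsApex S a) : Simple (valueModule S a) := by
  have := ha.nontrivial
  rw [simple_iff_isSimpleModule', isSimpleModule_iff_toSpanSingleton_surjective]
  refine ⟨(valueEquiv S a).symm.toEquiv.nontrivial, fun m hm t => ?_⟩
  obtain ⟨m, rfl⟩ := (valueEquiv S a).surjective m
  obtain ⟨t, rfl⟩ := (valueEquiv S a).surjective t
  have hm' : m ≠ 0 := by rintro rfl; exact hm (map_zero _)
  have hmem : t ∈ orbitSpan S m a := by simp [orbitSpan_eq_top S hm' a]
  change ∃ z : MonoidAlgebra k (Aut a), z • valueEquiv S a m = valueEquiv S a t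
  induction hmem using Submodule.span_induction with
  | mem _ h =>
    obtain ⟨u, rfl⟩ := h
    by_cases hu : IsIso u
    · refine ⟨MonoidAlgebra.single (autOfIsIso u hu) 1, ?_⟩
      rw [← valueEquiv_smul, one_smul]
      rfl
    · refine ⟨0, ?_⟩
      change _ = valueEquiv S a ((S.map u).hom m)
      rw [ha.map_eq_zero u hu, zero_smul]
      exact (map_zero _).symm
  | zero => exact ⟨0, by rw [zero_smul, map_zero]⟩
  | add _ _ _ _ h h' =>
    obtain ⟨z, hz⟩ := h
    obtain ⟨z', hz'⟩ := h'
    exact ⟨z + z', by rw [add_smul, hz, hz', map_add]⟩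
  | smul r s _ h =>
    obtain ⟨z, hz⟩ := h
    refine ⟨MonoidAlgebra.single 1 r * z, ?_⟩
    rw [mul_smul, hz, ← valueEquiv_smul]
    change valueEquiv S a (r • (S.map (𝟙 a)).hom s) = _
    simp

end Value

/-! ### From a simple module to a simple functor. -/

section Construction

variable {C : Type u} [Category.{v} C] {k : Type w} [Ring k] {a : C}

/-- A `k[Aut a]`-module as a `k`-module. -/
noncomputable abbrev baseModule (M : ModuleCat.{w} (MonoidAlgebra k (Aut a))) : ModuleCat.{w} k :=
  (ModuleCat.restrictScalars (MonoidAlgebra.singleOneRingHom (R := k) (M := Aut a))).obj M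

/-- The identity of a `k[Aut a]`-module. -/
noncomputable def baseEquiv (M : ModuleCat.{w} (MonoidAlgebra k (Aut a))) : baseModule M ≃+ M :=
  AddEquiv.refl _

theorem baseEquiv_smul (M : ModuleCat.{w} (MonoidAlgebra k (Aut a))) (r : k) (m : baseModule M) :
    baseEquiv M (r • m) = MonoidAlgebra.single (1 : Aut a) r • baseEquiv M m :=
  rfl

/-- The action of an automorphism on a `k[Aut a]`-module. -/
noncomputable def autAct (M : ModuleCat.{w} (MonoidAlgebra k (Aut a))) (g : Aut a) :
    baseModule M →ₗ[k] baseModule M where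
  toFun m := (baseEquiv M).symm (MonoidAlgebra.single g (1 : k) • baseEquiv M m)
  map_add' m n := by simp only [map_add, smul_add]
  map_smul' r m := by
    refine (baseEquiv M).injective ?_
    rw [RingHom.id_apply, baseEquiv_smul, baseEquiv_smul, AddEquiv.apply_symm_apply,
      AddEquiv.apply_symm_apply, ← mul_smul, ← mul_smul, MonoidAlgebra.single_mul_single,
      MonoidAlgebra.single_mul_single, one_mul, mul_one, one_mul, mul_one]

theorem baseEquiv_autAct (M : ModuleCat.{w} (MonoidAlgebra k (Aut a))) (g : Aut a)
    (m : baseModule M) :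
    baseEquiv M (autAct M g m) = MonoidAlgebra.single g (1 : k) • baseEquiv M m :=
  rfl

theorem baseEquiv_smul_autAct (M : ModuleCat.{w} (MonoidAlgebra k (Aut a))) (r : k) (g : Aut a)
    (m : baseModule M) :
    baseEquiv M (r • autAct M g m) = MonoidAlgebra.single g r • baseEquiv M m := by
  rw [baseEquiv_smul, baseEquiv_autAct, ← mul_smul, MonoidAlgebra.single_mul_single, one_mul,
    mul_one]

open Classical in
/-- The action of endomorphisms of `a` on a `k[Aut a]`-module, by zero if non-invertible. -/
noncomputable def endAct (M : ModuleCat.{w} (MonoidAlgebra k (Aut a))) (f : a ⟶ a) :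
    baseModule M →ₗ[k] baseModule M :=
  if h : IsIso f then autAct M (autOfIsIso f h) else 0

theorem endAct_hom (M : ModuleCat.{w} (MonoidAlgebra k (Aut a))) (g : Aut a) :
    endAct M g.hom = autAct M g := by
  rw [endAct, dif_pos (Iso.isIso_hom g)]
  congr 1
  exact Iso.ext rfl

theorem endAct_of_not_isIso (M : ModuleCat.{w} (MonoidAlgebra k (Aut a))) {f : a ⟶ a}
    (hf : ¬ IsIso f) : endAct M f = 0 :=
  dif_neg hf

theorem endAct_id (M : ModuleCat.{w} (MonoidAlgebra k (Aut a))) :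
    endAct M (𝟙 a) = LinearMap.id := by
  refine (endAct_hom M (1 : Aut a)).trans (LinearMap.ext fun m => (baseEquiv M).injective ?_)
  rw [baseEquiv_autAct]
  exact one_smul _ _

/-- Extension by zero is multiplicative because, by finiteness, a composite is invertible only if
both factors are. -/
theorem endAct_comp [Finite (a ⟶ a)] (M : ModuleCat.{w} (MonoidAlgebra k (Aut a)))
    (f g : a ⟶ a) : endAct M (f ≫ g) = endAct M g ∘ₗ endAct M f := by
  by_cases hf : IsIso f
  · by_cases hg : IsIso g
    · have h : endAct M (f ≫ g) = autAct M (autOfIsIso g hg * autOfIsIso f hf) :=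
        endAct_hom M (autOfIsIso g hg * autOfIsIso f hf)
      rw [h, endAct, endAct, dif_pos hf, dif_pos hg]
      refine LinearMap.ext fun m => (baseEquiv M).injective ?_
      rw [LinearMap.comp_apply, baseEquiv_autAct, baseEquiv_autAct, baseEquiv_autAct, ← mul_smul,
        MonoidAlgebra.single_mul_single, one_mul]
    · rw [endAct_of_not_isIso M hg, LinearMap.zero_comp,
        endAct_of_not_isIso M fun h => hg (isIso_of_isIso_comp_right h)]
  · rw [endAct_of_not_isIso M hf, LinearMap.comp_zero,
      endAct_of_not_isIso M fun h => hf (isIso_of_isIso_comp_left h)]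

theorem span_range_endAct (M : ModuleCat.{w} (MonoidAlgebra k (Aut a))) [Simple M]
    {m : baseModule M} (hm : m ≠ 0) :
    Submodule.span k (Set.range fun f => endAct M f m) = ⊤ := by
  refine eq_top_iff.mpr fun t _ => ?_
  have hm' : baseEquiv M m ≠ 0 := fun h => hm ((baseEquiv M).injective (h.trans (map_zero _).symm))
  obtain ⟨z, hz⟩ :=
    IsSimpleModule.toSpanSingleton_surjective (MonoidAlgebra k (Aut a)) hm' (baseEquiv M t)
  have key : ∀ z : MonoidAlgebra k (Aut a), (baseEquiv M).symm (z • baseEquiv M m) ∈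
      Submodule.span k (Set.range fun f => endAct M f m) := by
    intro z
    induction z using MonoidAlgebra.induction_linear with
    | zero => rw [zero_smul, map_zero]; exact zero_mem _
    | add z z' h h' => rw [add_smul, map_add]; exact add_mem h h'
    | single g r =>
      rw [← baseEquiv_smul_autAct, AddEquiv.symm_apply_apply, ← endAct_hom]
      exact Submodule.smul_mem _ _ (Submodule.subset_span ⟨g.hom, rfl⟩)
  have := key z
  rwa [show z • baseEquiv M m = baseEquiv M t from hz, AddEquiv.symm_apply_apply] at this

theorem exists_realization [LocallySmall.{w} C] [Finite (a ⟶ a)]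
    (M : ModuleCat.{w} (MonoidAlgebra k (Aut a))) [Simple M] :
    ∃ S : C ⥤ ModuleCat.{w} k, Simple S ∧ Nonempty (Realization M S) := by
  have : Nontrivial M := IsSimpleModule.nontrivial (MonoidAlgebra k (Aut a)) M
  have : Nontrivial (baseModule M) := (baseEquiv M).toEquiv.nontrivial
  let ev := imageFunctorEval (endAct_id M) (endAct_comp M)
  have hev := imageFunctorEval_map (endAct_id M) (endAct_comp M)
  refine ⟨imageFunctor (endAct M), simple_imageFunctor (endAct_id M) (endAct_comp M)
    fun m hm => span_range_endAct M hm,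
    ⟨{ map_eq_zero := fun f hf => ?_
       equiv := ev.toAddEquiv.trans (baseEquiv M)
       equiv_smul := fun r g m => ?_ }⟩⟩
  · ext m
    refine ev.injective ((hev f m).trans ?_)
    rw [endAct_of_not_isIso M hf]
    exact (map_zero ev).symm
  · change baseEquiv M (ev (r • ((imageFunctor (endAct M)).map g.hom).hom m)) =
      MonoidAlgebra.single g r • baseEquiv M (ev m)
    rw [← baseEquiv_smul_autAct, ← endAct_hom, map_smul]
    exact congr_arg (fun t => baseEquiv M (r • t)) (hev g.hom m)

end Construction

/-! ### Isomorphism classes and the bijection. -/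

theorem mk_eq_mk_iff {E : Type u} [Category.{v} E] [Limits.HasZeroMorphisms E] {X Y : E}
    [Simple X] [Simple Y] : Irr.mk X = Irr.mk Y ↔ Nonempty (X ≅ Y) :=
  Quotient.eq

theorem exists_mk_eq {E : Type u} [Category.{v} E] [Limits.HasZeroMorphisms E] (q : Irr E) :
    ∃ (X : E) (_ : Simple X), Irr.mk X = q := by
  obtain ⟨⟨X, hX⟩, rfl⟩ := Quotient.exists_rep q
  exact ⟨X, hX, rfl⟩

/-- The class of `k[Aut a]`-modules and the class of functors have representatives such that the
functor is realized by the module. -/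
def Corresponds {C : Type u} [Category.{v} C] {k : Type w} [Ring k] {a : C}
    (p : Irr (ModuleCat.{w} (MonoidAlgebra k (Aut a)))) (q : Irr (C ⥤ ModuleCat.{w} k)) : Prop :=
  ∃ (M : ModuleCat.{w} (MonoidAlgebra k (Aut a))) (_ : Simple M) (S : C ⥤ ModuleCat.{w} k)
    (_ : Simple S), p = Irr.mk M ∧ q = Irr.mk S ∧ Nonempty (Realization M S)

/-- Realizations transport along isomorphisms on both sides, so the choice of representatives is
immaterial. -/
theorem Corresponds.nonempty_realization {C : Type u} [Category.{v} C] {k : Type w} [Ring k]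
    {a : C} {M : ModuleCat.{w} (MonoidAlgebra k (Aut a))} [Simple M] {S : C ⥤ ModuleCat.{w} k}
    [Simple S] (h : Corresponds (Irr.mk M) (Irr.mk S)) : Nonempty (Realization M S) := by
  obtain ⟨M', _, S', _, hM, hS, ⟨R⟩⟩ := h
  obtain ⟨i⟩ := mk_eq_mk_iff.mp hM
  obtain ⟨j⟩ := mk_eq_mk_iff.mp hS
  exact ⟨(R.ofIso j.symm).ofModuleIso i.symm⟩

end SimpleFunctor

open SimpleFunctor in
theorem mainTheorem8 {C : Type u} [Category.{v} C] [EssentiallySmall.{w} C]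
    [IsIdempotentComplete C] (hfin : ∀ x : C, Finite (x ⟶ x))
    (k : Type w) [Ring k]
    (rep : IsoClass C → C) (hrep : ∀ c, IsoClass.mk (rep c) = c) :
    ∃ Φ : (Σ c : IsoClass C, Irr (ModuleCat.{w} (MonoidAlgebra k (Aut (rep c))))) ≃
        Irr (C ⥤ ModuleCat.{w} k),
      ∀ (c : IsoClass C) (M : ModuleCat.{w} (MonoidAlgebra k (Aut (rep c)))) [Simple M]
        (S : C ⥤ ModuleCat.{w} k) [Simple S], Φ ⟨c, Irr.mk M⟩ = Irr.mk S →
        Nonempty (End M ≃+* End S) ∧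
        (∀ f : rep c ⟶ rep c, ¬ IsIso f → S.map f = 0) ∧
        ∃ e : S.obj (rep c) ≃+ M, ∀ (r : k) (g : Aut (rep c)) (m : S.obj (rep c)),
          e (r • (S.map g.hom).hom m) = MonoidAlgebra.single g r • e m := by
  have hex : ∀ p : Σ c : IsoClass C, Irr (ModuleCat.{w} (MonoidAlgebra k (Aut (rep c)))),
      ∃ q : Irr (C ⥤ ModuleCat.{w} k), Corresponds p.2 q := by
    rintro ⟨c, p⟩
    obtain ⟨M, _, rfl⟩ := exists_mk_eq p
    have := hfin (rep c)
    obtain ⟨S, _, hR⟩ := exists_realization M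
    exact ⟨Irr.mk S, M, inferInstance, S, inferInstance, rfl, rfl, hR⟩
  choose φ hφ using hex
  have hinj : Function.Injective φ := by
    rintro ⟨c, p⟩ ⟨c', p'⟩ h
    obtain ⟨M, _, rfl⟩ := exists_mk_eq p
    obtain ⟨M', _, rfl⟩ := exists_mk_eq p'
    obtain ⟨S, _, hS⟩ := exists_mk_eq (φ ⟨c, Irr.mk M⟩)
    have h₁ := hφ ⟨c, Irr.mk M⟩
    have h₂ := hφ ⟨c', Irr.mk M'⟩
    rw [← h, ← hS] at h₂
    rw [← hS] at h₁
    obtain ⟨R⟩ := h₁.nonempty_realization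
    obtain ⟨R'⟩ := h₂.nonempty_realization
    -- Both representatives are apexes of the same `S`.
    obtain rfl : c = c' := by
      rw [← hrep c, ← hrep c']
      exact Quotient.sound (R.isApex.nonempty_iso R'.isApex)
    rw [mk_eq_mk_iff.mpr (R.nonempty_iso_module R' (Iso.refl S))]
  have hsurj : Function.Surjective φ := by
    intro q
    obtain ⟨S, _, rfl⟩ := exists_mk_eq q
    obtain ⟨a, ha⟩ := exists_isApex hfin S
    obtain ⟨i⟩ : Nonempty (rep (IsoClass.mk a) ≅ a) := Quotient.exact (hrep (IsoClass.mk a))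
    have hb := ha.of_iso i.symm
    have := hb.simple_valueModule
    refine ⟨⟨IsoClass.mk a, Irr.mk (valueModule S _)⟩, ?_⟩
    obtain ⟨T, _, hT⟩ := exists_mk_eq (φ ⟨IsoClass.mk a, Irr.mk (valueModule S _)⟩)
    have h₁ := hφ ⟨IsoClass.mk a, Irr.mk (valueModule S _)⟩
    rw [← hT] at h₁ ⊢
    obtain ⟨R⟩ := h₁.nonempty_realization
    -- `T` and `S` realize the same module.
    exact mk_eq_mk_iff.mpr (R.nonempty_iso_functor hb.realization (Iso.refl _))
  refine ⟨Equiv.ofBijective φ ⟨hinj, hsurj⟩, fun c M _ S _ h => ?_⟩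
  have h₁ := hφ ⟨c, Irr.mk M⟩
  rw [show φ ⟨c, Irr.mk M⟩ = Irr.mk S from h] at h₁
  obtain ⟨R⟩ := h₁.nonempty_realization
  exact ⟨⟨R.endEquiv.symm⟩, R.map_eq_zero, R.equiv, R.equiv_smul⟩
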